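/- **Conventions.** Let $K$ be a poset. *Paths and homotopy.* A 1-simplex $b:a\to o$ of $K$ consists of faces $\partial_1 b=a$, $\partial_0b=o$ in $K$ and a support $|b|\in K$ with $a,o\le|b|$; for $a\le o$, $(oa)$ denotes the 1-simplex $a\to o$ with support $o$. A 2-simplex $c$ consists of 1-simplices $\partial_2c:a\to e$, $\partial_0c:e\to o$, $\partial_1c:a\to o$ and a support $|c|\in K$ with $|\partial_ic|\le|c|$ for $i=0,1,2$. A path $p:a\to o$ is a nonempty composable string $b_n*\cdots*b_1$ of 1-simplices starting at $a$ and ending at $o$. Two paths are homotopic, $p\sim q$, if one is obtained from the other by finitely many replacements of $\partial_0c*\partial_2c$ by $\partial_1c$, or conversely. A nonempty subset $P\subseteq K$, with the induced order, is pathwise connected if any two of its elements are joined by a path in $P$. A pathwise connected $P$ is simply connected if every loop in $P$ over $o\in P$ is homotopic in $P$ to the trivial loop $\iota_o=(oo)$, for all $o\in P$. *Nets.* A net of $C^*$-algebras $(\mathcal A,\jmath)_K$ consists of unital $C^*$-algebras $\mathcal A_o$, $o\in K$, and unital faithful $*$-morphisms $\jmath_{oa}:\mathcal A_a\to\mathcal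 A_o$, $a\le o$, with $\jmath_{oa}\circ\jmath_{ae}=\jmath_{oe}$ for $e\le a\le o$. It is a $C^*$-net bundle if all $\jmath_{oa}$ are $*$-isomorphisms. $(\mathcal A,\jmath)_P$ is the restriction to $P\subseteq K$. A morphism $\phi$ from $(\mathcal A,\jmath)_K$ to $(\mathcal B,\imath)_K$ is a family of (not necessarily unital) $*$-morphisms $\phi_o:\mathcal A_o\to\mathcal B_o$ with $\phi_o\circ\jmath_{oa}=\imath_{oa}\circ\phi_a$; it is a monomorphism if all $\phi_o$ are faithful. A faithful Hilbert space representation of a net consists of a Hilbert space $H$ and faithful representations $\pi_o:\mathcal A_o\to\mathcal B(H)$ with $\pi_o\circ\jmath_{oa}=\pi_a$ for all $a\le o$. *Injectivity.* For $o\in K$ let $\overline{\mathcal A}^{\,0}_o$ be the unital $*$-algebra generated by the symbols $(p,A)$, where $p$ is a path ending at $o$ and $A$ is in the fibre over the starting point of $p$, with adjoint $(p,A)^*=(p,A^*)$ and relations: $(p,A)$ is linear and multiplicative in $A$; $(p,1)=1$; $(p,\jmath_{\tilde aa}(A))=(p*(\tilde aa),A)$ for $a\le\tilde a$; $(p,A)=(q,A)$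 if $p\sim q$. With the $*$-isomorphisms $\overline\jmath_{\tilde oo}(p,A)=((\tilde oo)*p,A)$, $o\le\tilde o$, this is a net of $*$-algebras. Put $\|W\|=\sup_\pi\|\pi_o(W)\|$, over all morphisms $\pi$ from $(\overline{\mathcal A}^{\,0},\overline\jmath)_K$ to $C^*$-net bundles over $K$. Dividing by the null elements and completing yields a $C^*$-net bundle $(\overline{\mathcal A},\overline\jmath)_K$, the enveloping net bundle; the canonical embedding is the morphism $\epsilon_o(A)=(\iota_o,A)$. The net is injective if its enveloping net bundle does not vanish (not all its fibres are $\{0\}$) and the canonical embedding is a monomorphism. *Čech cocycle.* An $n$-simplex of $\Sigma^\circ_*(K)$ is a string $(F;o_{n+1},\dots,o_1)$ with vertices $o_i\in K$ and support a nonempty subset $F\subseteq K$ such that $a\le o_i$ for all $a\in F$ and all $i$. Faces omit a vertex, degeneracies repeat a vertex, and permutations permute the vertices; all of them keep $F$. For $P\subseteq K$, $\Sigma^\circ_*(P)$ consists of the simplices with $F\subseteq P$ and all vertices in $P$. For $F\le o$ let $\mathcal A^F_o\subseteq\mathcal A_o$ be the $C^*$-subalgebra generated by the $\jmath_{oa}(\mathcal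 A_a)$, $a\in F$. Let $D_*$ be a symmetric subsimplicial set of $\Sigma^\circ_*(K)$ (a subset in each degree, stable under faces, degeneracies and permutations). A Čech cocycle of the net defined over $D_*$ is a family of $*$-isomorphisms $\zeta^F_{\tilde oo}:\mathcal A^F_o\to\mathcal A^F_{\tilde o}$, $(F;\tilde o,o)\in D_1$, with $\zeta^F_{\tilde oo}\circ\jmath_{oa}=\jmath_{\tilde oa}$ for all $a\in F$. The domain of the Čech cocycle of the net is the largest symmetric subsimplicial set of $\Sigma^\circ_*(K)$ over which a Čech cocycle is defined (the union of all of them). **Statement.** Let $(\mathcal A,\jmath)_K$ be a net of $C^*$-algebras over a poset $K$. 1. If $P\subseteq K$ is pathwise connected and $(\mathcal A,\jmath)_P$ has a faithful Hilbert space representation, then $\Sigma^\circ_*(P)$ is contained in the domain of the Čech cocycle of $(\mathcal A,\jmath)_K$. 2. If $(\mathcal A,\jmath)_K$ is injective, then $\Sigma^\circ_*(P)$ is contained in the domain of the Čech cocycle of $(\mathcal A,\jmath)_K$ for every pathwise connected and simply connected subset $P$ of $K$. -/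

import Mathlib

universe u v w

noncomputable section

/-! ## Singular simplices, paths and homotopy of a poset -/

/-- A singular 1-simplex `b` of the poset `K` with `∂₁ b = a` and `∂₀ b = o`:
an element of `K` (the support) which is larger than both faces. -/
structure PosetSimplexOne {K : Type u} [PartialOrder K] (a o : K) where
  supp : K
  le_source : a ≤ supp
  le_target : o ≤ supp

/-- A singular 2-simplex `c` of the poset `K` with vertices `a, e, o`: its faces
`∂₀ c : e → o`, `∂₁ c : a → o`, `∂₂ c : a → e` are 1-simplices whose supports are smaller than
the support of `c`. -/
structure PosetSimplexTwo {K : Type u} [PartialOrder K] (a e o : K) where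
  supp : K
  face₀ : PosetSimplexOne e o
  face₁ : PosetSimplexOne a o
  face₂ : PosetSimplexOne a e
  le₀ : face₀.supp ≤ supp
  le₁ : face₁.supp ≤ supp
  le₂ : face₂.supp ≤ supp

/-- The 1-simplex `(o a)` of the nerve attached to `a ≤ o`: from `a` to `o`, with support `o`. -/
def PosetSimplexOne.nerve {K : Type u} [PartialOrder K] {a o : K} (h : a ≤ o) :
    PosetSimplexOne a o := ⟨o, h, le_rfl⟩

/-- The opposite 1-simplex. -/
def PosetSimplexOne.opposite {K : Type u} [PartialOrder K] {a o : K} (b : PosetSimplexOne a o) :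
    PosetSimplexOne o a := ⟨b.supp, b.le_target, b.le_source⟩

/-- `PosetPath a o` is the type of paths `p : a → o`, i.e. of nonempty composable strings
`bₙ * ⋯ * b₁` of 1-simplices with `∂₁ b₁ = a` and `∂₀ bₙ = o`. -/
inductive PosetPath {K : Type u} [PartialOrder K] : K → K → Type u
  | single {a o : K} (b : PosetSimplexOne a o) : PosetPath a o
  | cons {a e o : K} (b : PosetSimplexOne e o) (p : PosetPath a e) : PosetPath a o

namespace PosetPath

variable {K : Type u} [PartialOrder K]

/-- The composition `q * p` of `p : a → e` and `q : e → o`. -/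
def comp : {a e o : K} → PosetPath e o → PosetPath a e → PosetPath a o
  | _, _, _, single b, p => cons b p
  | _, _, _, cons b q, p => cons b (comp q p)

/-- The trivial loop over `o`, i.e. the degenerate 1-simplex `σ₀ o`. -/
def trivial (o : K) : PosetPath o o := single (PosetSimplexOne.nerve le_rfl)

/-- `Deform p q`: the path `q` arises from `p` by replacing two subsequent 1-simplices
`∂₀ c * ∂₂ c` of `p` by `∂₁ c`, for a 2-simplex `c`. -/
inductive Deform : {a o : K} → PosetPath a o → PosetPath a o → Prop
  | face {a e o : K} (c : PosetSimplexTwo a e o) :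
      Deform (comp (single c.face₀) (single c.face₂)) (single c.face₁)
  | right {a e o : K} {p q : PosetPath e o} (r : PosetPath a e) (h : Deform p q) :
      Deform (comp p r) (comp q r)
  | left {a e o : K} (r : PosetPath e o) {p q : PosetPath a e} (h : Deform p q) :
      Deform (comp r p) (comp r q)

/-- Homotopy of paths: finite sequences of deformations (in both directions). -/
def Homotopic {a o : K} (p q : PosetPath a o) : Prop := Relation.EqvGen Deform p q

theorem comp_assoc {a e f o : K} (r : PosetPath f o) (q : PosetPath e f) (p : PosetPath a e) :
    comp (comp r q) p = comp r (comp q p) := by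
  induction r with
  | single b => simp only [comp]
  | cons b r ih => simp only [comp, ih]

theorem Homotopic.comp_left {a e o : K} (r : PosetPath e o) {p q : PosetPath a e}
    (h : Homotopic p q) : Homotopic (comp r p) (comp r q) := by
  induction h with
  | rel x y h => exact .rel _ _ (.left r h)
  | refl x => exact .refl _
  | symm x y _ ih => exact .symm _ _ ih
  | trans x y z _ _ ih₁ ih₂ => exact .trans _ _ _ ih₁ ih₂

theorem Homotopic.comp_right {a e o : K} {p q : PosetPath e o} (r : PosetPath a e)
    (h : Homotopic p q) : Homotopic (comp p r) (comp q r) := by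
  induction h with
  | rel x y h => exact .rel _ _ (.right r h)
  | refl x => exact .refl _
  | symm x y _ ih => exact .symm _ _ ih
  | trans x y z _ _ ih₁ ih₂ => exact .trans _ _ _ ih₁ ih₂

theorem trivial_comp {a o : K} (p : PosetPath a o) : Homotopic (comp (trivial o) p) p := by
  have key : ∀ {a o : K} (b : PosetSimplexOne a o),
      Homotopic (comp (trivial o) (single b)) (single b) := fun {a o} b =>
    .rel _ _ (.face ⟨b.supp, PosetSimplexOne.nerve le_rfl, b, b, b.le_target, le_rfl, le_rfl⟩)
  cases p with
  | single b => exact key b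
  | cons b p =>
    have := (key b).comp_right p
    simpa only [comp_assoc, comp] using this

theorem nerve_comp_nerve {a e o : K} (h₁ : a ≤ e) (h₂ : e ≤ o) :
    Homotopic (comp (single (.nerve h₂)) (single (.nerve h₁)))
      (single (.nerve (h₁.trans h₂))) :=
  .rel _ _ (.face ⟨o, .nerve h₂, .nerve (h₁.trans h₂), .nerve h₁, le_rfl, le_rfl, h₂⟩)

theorem opposite_comp_nerve {a o : K} (h : a ≤ o) :
    Homotopic (comp (single (PosetSimplexOne.nerve h).opposite) (single (.nerve h)))
      (trivial a) :=
  .rel _ _ (.face ⟨o, (PosetSimplexOne.nerve h).opposite, .nerve le_rfl, .nerve h,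
    le_rfl, h, le_rfl⟩)

theorem nerve_comp_opposite {a o : K} (h : a ≤ o) :
    Homotopic (comp (single (.nerve h)) (single (PosetSimplexOne.nerve h).opposite))
      (trivial o) :=
  .rel _ _ (.face ⟨o, .nerve h, .nerve le_rfl, (PosetSimplexOne.nerve h).opposite,
    le_rfl, le_rfl, le_rfl⟩)

end PosetPath

/-- A (nonempty) poset is pathwise connected if any two of its elements are joined by a path. -/
def PosetConnected (K : Type u) [PartialOrder K] : Prop :=
  Nonempty K ∧ ∀ a o : K, Nonempty (PosetPath a o)

/-- The fundamental groups of the poset are trivial: every loop is homotopic to the trivial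
loop over its base point. -/
def PosetSimplyConnected (K : Type u) [PartialOrder K] : Prop :=
  ∀ (o : K) (p : PosetPath o o), PosetPath.Homotopic p (PosetPath.trivial o)

/-! ## Nets of C⋆-algebras -/

/-- A net of unital C⋆-algebras over the poset `K`. The inclusion maps are unital faithful
⋆-morphisms which satisfy the net relations. -/
structure CStarNet (K : Type u) [PartialOrder K] where
  fiber : K → Type v
  [cstar : ∀ o, CStarAlgebra (fiber o)]
  incl : ∀ {a o : K}, a ≤ o → (fiber a →⋆ₐ[ℂ] fiber o)
  incl_injective : ∀ {a o : K} (h : a ≤ o), Function.Injective (incl h)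
  incl_incl : ∀ {e a o : K} (h₁ : e ≤ a) (h₂ : a ≤ o) (x : fiber e),
    incl h₂ (incl h₁ x) = incl (h₁.trans h₂) x

attribute [instance] CStarNet.cstar

namespace CStarNet

variable {K : Type u} [PartialOrder K]

/-- A net is a C⋆-net bundle if all its inclusion maps are ⋆-isomorphisms. -/
def IsNetBundle (A : CStarNet.{u, v} K) : Prop :=
  ∀ {a o : K} (h : a ≤ o), Function.Bijective (A.incl h)

/-- The restriction of a net to a subset of the poset. -/
def restrict (A : CStarNet.{u, v} K) (P : Set K) : CStarNet.{u, v} P where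
  fiber o := A.fiber o
  incl {a o} h := A.incl (a := (a : K)) (o := (o : K)) h
  incl_injective {a o} h := A.incl_injective (a := (a : K)) (o := (o : K)) h
  incl_incl {e a o} h₁ h₂ x := A.incl_incl (e := (e : K)) (a := (a : K)) (o := (o : K)) h₁ h₂ x

/-- A net vanishes if it is isomorphic to the null net bundle, i.e. all its fibres are `{0}`. -/
def Vanishes (A : CStarNet.{u, v} K) : Prop := ∀ o, Subsingleton (A.fiber o)

/-- Morphisms (over the identity of `K`) of nets of C⋆-algebras; they need not be unital. -/
structure Morphism (A : CStarNet.{u, v} K) (B : CStarNet.{u, w} K) where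
  map : ∀ o, A.fiber o →⋆ₙₐ[ℂ] B.fiber o
  map_incl : ∀ {a o : K} (h : a ≤ o) (x : A.fiber a), map o (A.incl h x) = B.incl h (map a x)

/-- A morphism over the identity of `K` is a monomorphism if it is faithful on every fibre. -/
def Morphism.IsMono {A : CStarNet.{u, v} K} {B : CStarNet.{u, w} K} (φ : Morphism A B) : Prop :=
  ∀ o, Function.Injective (φ.map o)

/-- `(A, j)_K` has a faithful Hilbert space representation: there are a Hilbert space `H` and
faithful representations `π o` of the fibres on `H` with `π o ∘ j_{oa} = π a` for `a ≤ o`.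
The representations need not be unital. -/
def HasFaithfulHilbertSpaceRep (A : CStarNet.{u, v} K) : Prop :=
  ∃ (H : Type w) (_ : NormedAddCommGroup H) (_ : InnerProductSpace ℂ H) (_ : CompleteSpace H)
    (π : ∀ o, A.fiber o →⋆ₙₐ[ℂ] (H →L[ℂ] H)),
    (∀ o, Function.Injective (π o)) ∧
    ∀ {a o : K} (h : a ≤ o) (x : A.fiber a), π o (A.incl h x) = π a x

/-! ## The enveloping net bundle -/

variable (A : CStarNet.{u, v} K)

/-- The symbols `(p, x)` with `p` a path ending at `o` and `x` in the fibre over the starting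
point of `p`. -/
abbrev EnvGen (o : K) : Type (max u v) := Σ a : K, PosetPath a o × A.fiber a

/-- The symbol `(p, x)` in the free unital algebra. -/
def freeGen {a o : K} (p : PosetPath a o) (x : A.fiber a) : FreeAlgebra ℂ (A.EnvGen o) :=
  FreeAlgebra.ι ℂ (⟨a, p, x⟩ : A.EnvGen o)

/-- The relations imposed on the symbols `(p, x)`. -/
inductive EnvRel (o : K) : FreeAlgebra ℂ (A.EnvGen o) → FreeAlgebra ℂ (A.EnvGen o) → Prop
  | mul {a : K} (p : PosetPath a o) (x y : A.fiber a) :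
      EnvRel o (A.freeGen p x * A.freeGen p y) (A.freeGen p (x * y))
  | add {a : K} (p : PosetPath a o) (x y : A.fiber a) :
      EnvRel o (A.freeGen p (x + y)) (A.freeGen p x + A.freeGen p y)
  | smul {a : K} (p : PosetPath a o) (c : ℂ) (x : A.fiber a) :
      EnvRel o (A.freeGen p (c • x)) (c • A.freeGen p x)
  | one {a : K} (p : PosetPath a o) : EnvRel o (A.freeGen p 1) 1
  | zero {a : K} (p : PosetPath a o) : EnvRel o (A.freeGen p 0) 0
  | isotony {a a' : K} (h : a ≤ a') (p : PosetPath a' o) (x : A.fiber a) :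
      EnvRel o (A.freeGen p (A.incl h x)) (A.freeGen (p.comp (.single (.nerve h))) x)
  | homotopy {a : K} {p q : PosetPath a o} (h : PosetPath.Homotopic p q) (x : A.fiber a) :
      EnvRel o (A.freeGen p x) (A.freeGen q x)

/-- The unital ⋆-algebra over `o` generated by the symbols `(p, x)` with the above relations. -/
def EnvAlg (o : K) : Type (max u v) := RingQuot (A.EnvRel o)

instance (o : K) : Ring (A.EnvAlg o) := inferInstanceAs (Ring (RingQuot (A.EnvRel o)))

instance (o : K) : Algebra ℂ (A.EnvAlg o) := inferInstanceAs (Algebra ℂ (RingQuot (A.EnvRel o)))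

/-- The quotient map from the free algebra. -/
def envMk (o : K) : FreeAlgebra ℂ (A.EnvGen o) →ₐ[ℂ] A.EnvAlg o := RingQuot.mkAlgHom ℂ (A.EnvRel o)

/-- The class of the symbol `(p, x)`. -/
def gen {a o : K} (p : PosetPath a o) (x : A.fiber a) : A.EnvAlg o := A.envMk o (A.freeGen p x)

section relations

variable {A} {a o : K}

theorem gen_mul (p : PosetPath a o) (x y : A.fiber a) :
    A.gen p (x * y) = A.gen p x * A.gen p y := by
  have := RingQuot.mkAlgHom_rel ℂ (EnvRel.mul p x y)
  rw [map_mul] at this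
  exact this.symm

theorem gen_add (p : PosetPath a o) (x y : A.fiber a) :
    A.gen p (x + y) = A.gen p x + A.gen p y := by
  have := RingQuot.mkAlgHom_rel ℂ (EnvRel.add p x y)
  rw [map_add] at this
  exact this

theorem gen_smul (p : PosetPath a o) (c : ℂ) (x : A.fiber a) :
    A.gen p (c • x) = c • A.gen p x := by
  have := RingQuot.mkAlgHom_rel ℂ (EnvRel.smul p c x)
  rw [map_smul] at this
  exact this

theorem gen_one (p : PosetPath a o) : A.gen p 1 = 1 := by
  have := RingQuot.mkAlgHom_rel ℂ (EnvRel.one (A := A) p)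
  rw [map_one] at this
  exact this

theorem gen_zero (p : PosetPath a o) : A.gen p 0 = 0 := by
  have := RingQuot.mkAlgHom_rel ℂ (EnvRel.zero (A := A) p)
  rw [map_zero] at this
  exact this

theorem gen_isotony {a' : K} (h : a ≤ a') (p : PosetPath a' o) (x : A.fiber a) :
    A.gen p (A.incl h x) = A.gen (p.comp (.single (.nerve h))) x :=
  RingQuot.mkAlgHom_rel ℂ (EnvRel.isotony h p x)

theorem gen_homotopy {p q : PosetPath a o} (h : PosetPath.Homotopic p q) (x : A.fiber a) :
    A.gen p x = A.gen q x :=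
  RingQuot.mkAlgHom_rel ℂ (EnvRel.homotopy h x)

theorem envAlg_induction {o : K} {C : A.EnvAlg o → Prop}
    (hgen : ∀ (a : K) (p : PosetPath a o) x, C (A.gen p x))
    (hadd : ∀ x y, C x → C y → C (x + y)) (hmul : ∀ x y, C x → C y → C (x * y))
    (W : A.EnvAlg o) : C W := by
  obtain ⟨W, rfl⟩ := RingQuot.mkAlgHom_surjective ℂ (A.EnvRel o) W
  change C (A.envMk o W)
  induction W using FreeAlgebra.induction with
  | grade0 c =>
    have : A.envMk o (algebraMap ℂ _ c) = A.gen (PosetPath.trivial o) (c • 1) := by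
      rw [gen_smul, gen_one, AlgHom.commutes, Algebra.algebraMap_eq_smul_one]
    rw [this]
    exact hgen _ _ _
  | grade1 x => exact hgen x.1 x.2.1 x.2.2
  | mul x y hx hy => rw [map_mul]; exact hmul _ _ hx hy
  | add x y hx hy => rw [map_add]; exact hadd _ _ hx hy

theorem lift_freeGen {o : K} {B : Type*} [Ring B] [Algebra ℂ B]
    (f : ∀ a : K, PosetPath a o → A.fiber a → B) (p : PosetPath a o) (x : A.fiber a) :
    FreeAlgebra.lift ℂ (fun s : A.EnvGen o => f s.1 s.2.1 s.2.2) (A.freeGen p x) = f a p x :=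
  FreeAlgebra.lift_ι_apply _ _

/-- Algebra morphisms out of `EnvAlg` from maps on symbols that respect the relations. -/
def envLift {o : K} {B : Type*} [Ring B] [Algebra ℂ B]
    (f : ∀ a : K, PosetPath a o → A.fiber a → B)
    (hmul : ∀ a p x y, f a p (x * y) = f a p x * f a p y)
    (hadd : ∀ a p x y, f a p (x + y) = f a p x + f a p y)
    (hsmul : ∀ a p (c : ℂ) x, f a p (c • x) = c • f a p x)
    (hone : ∀ a p, f a p 1 = 1)
    (hiso : ∀ (a a' : K) (h : a ≤ a') p x,
      f a' p (A.incl h x) = f a (p.comp (.single (.nerve h))) x)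
    (hhom : ∀ (a : K) (p q : PosetPath a o), p.Homotopic q → ∀ x, f a p x = f a q x) :
    A.EnvAlg o →ₐ[ℂ] B :=
  RingQuot.liftAlgHom ℂ ⟨FreeAlgebra.lift ℂ (fun s : A.EnvGen o => f s.1 s.2.1 s.2.2), by
    intro x y h
    induction h with
    | mul p x y => simp only [map_mul, lift_freeGen, hmul]
    | add p x y => simp only [map_add, lift_freeGen, hadd]
    | smul p c x => simp only [map_smul, lift_freeGen, hsmul]
    | one p => simp only [map_one, lift_freeGen, hone]
    | zero p => simpa only [map_zero, lift_freeGen, zero_smul] using hsmul _ p 0 0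
    | isotony h p x => simp only [lift_freeGen, hiso _ _ h]
    | homotopy h x => simp only [lift_freeGen, hhom _ _ _ h]⟩

theorem envLift_gen {o : K} {B : Type*} [Ring B] [Algebra ℂ B]
    (f : ∀ a : K, PosetPath a o → A.fiber a → B) (h₁ h₂ h₃ h₄ h₅ h₆) (p : PosetPath a o)
    (x : A.fiber a) : envLift f h₁ h₂ h₃ h₄ h₅ h₆ (A.gen p x) = f a p x := by
  unfold envLift gen envMk
  exact (RingQuot.liftAlgHom_mkAlgHom_apply ℂ _ _ _).trans (lift_freeGen f p x)

end relations

/-- The opposite of a complex algebra with the conjugate scalar multiplication. -/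
def ConjOp (B : Type*) : Type _ := Bᵐᵒᵖ

instance (B : Type*) [Ring B] : Ring (ConjOp B) := inferInstanceAs (Ring Bᵐᵒᵖ)

instance (B : Type*) [Ring B] [Algebra ℂ B] : Algebra ℂ (ConjOp B) :=
  RingHom.toAlgebra' ((algebraMap ℂ Bᵐᵒᵖ).comp (starRingEnd ℂ))
    (fun c x => Algebra.commutes (A := Bᵐᵒᵖ) (starRingEnd ℂ c) x)

/-- The identity map onto `ConjOp B`. -/
def ConjOp.op {B : Type*} (x : B) : ConjOp B := MulOpposite.op x

/-- The identity map from `ConjOp B`. -/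
def ConjOp.unop {B : Type*} (x : ConjOp B) : B := MulOpposite.unop x

theorem ConjOp.smul_def {B : Type*} [Ring B] [Algebra ℂ B] (c : ℂ) (x : ConjOp B) :
    c • x = ConjOp.op (starRingEnd ℂ c • ConjOp.unop x) :=
  (Algebra.smul_def (A := Bᵐᵒᵖ) (starRingEnd ℂ c) x).symm

/-- The adjoint as an algebra morphism into the conjugate opposite algebra. -/
def envStarHom (o : K) : A.EnvAlg o →ₐ[ℂ] ConjOp (A.EnvAlg o) :=
  envLift (fun a p x => ConjOp.op (A.gen p (star x)))
    (fun a p x y => by rw [star_mul, gen_mul]; rfl)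
    (fun a p x y => by rw [star_add, gen_add]; rfl)
    (fun a p c x => by rw [ConjOp.smul_def, star_smul, gen_smul]; rfl)
    (fun a p => by rw [star_one, gen_one]; rfl)
    (fun a a' h p x => by rw [← map_star, gen_isotony])
    (fun a p q h x => by rw [gen_homotopy h])

/-- The adjoint on `EnvAlg`: it is antilinear and antimultiplicative, and
`(p, x)⋆ = (p, x⋆)`. -/
instance (o : K) : Star (A.EnvAlg o) := ⟨fun W => ConjOp.unop (A.envStarHom o W)⟩

theorem star_gen {a o : K} (p : PosetPath a o) (x : A.fiber a) :
    star (A.gen p x) = A.gen p (star x) := by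
  change ConjOp.unop (A.envStarHom o (A.gen p x)) = _
  unfold envStarHom
  rw [envLift_gen]
  rfl

theorem envStar_add {o : K} (x y : A.EnvAlg o) : star (x + y) = star x + star y := by
  change ConjOp.unop (A.envStarHom o (x + y)) = _
  rw [map_add]; rfl

theorem envStar_mul {o : K} (x y : A.EnvAlg o) : star (x * y) = star y * star x := by
  change ConjOp.unop (A.envStarHom o (x * y)) = _
  rw [map_mul]; rfl

instance (o : K) : StarRing (A.EnvAlg o) where
  star_involutive W := by
    induction W using envAlg_induction with
    | hgen a p x => rw [star_gen, star_gen, star_star]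
    | hadd x y hx hy => rw [envStar_add, envStar_add, hx, hy]
    | hmul x y hx hy => rw [envStar_mul, envStar_mul, hx, hy]
  star_mul := A.envStar_mul
  star_add := A.envStar_add

instance (o : K) : StarModule ℂ (A.EnvAlg o) where
  star_smul c W := by
    change ConjOp.unop (A.envStarHom o (c • W)) = _
    rw [map_smul]
    rw [ConjOp.smul_def]
    rfl

/-- Transport along a path `q : o → o'`: the ⋆-morphism with `(p, x) ↦ (q * p, x)`. -/
def envTransport {o o' : K} (q : PosetPath o o') : A.EnvAlg o →⋆ₐ[ℂ] A.EnvAlg o' :=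
  let f : A.EnvAlg o →ₐ[ℂ] A.EnvAlg o' := envLift (fun _ p x => A.gen (q.comp p) x)
    (fun _ _ _ _ => gen_mul _ _ _) (fun _ _ _ _ => gen_add _ _ _) (fun _ _ _ _ => gen_smul _ _ _)
    (fun _ _ => gen_one _)
    (fun _ _ h p x => by rw [gen_isotony, PosetPath.comp_assoc])
    (fun _ _ _ h x => gen_homotopy (h.comp_left q) x)
  { f with
    map_star' := fun W => by
      change f (star W) = star (f W)
      induction W using envAlg_induction with
      | hgen a p x => rw [star_gen, envLift_gen, envLift_gen, star_gen]
      | hadd x y hx hy => rw [star_add, map_add, map_add, star_add, hx, hy]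
      | hmul x y hx hy => rw [star_mul, map_mul, map_mul, star_mul, hx, hy] }

theorem envTransport_gen {a o o' : K} (q : PosetPath o o') (p : PosetPath a o) (x : A.fiber a) :
    A.envTransport q (A.gen p x) = A.gen (q.comp p) x :=
  envLift_gen (A := A) _ _ _ _ _ _ _ p x

theorem envTransport_comp {o o' o'' : K} (r : PosetPath o' o'') (q : PosetPath o o')
    (W : A.EnvAlg o) : A.envTransport r (A.envTransport q W) = A.envTransport (r.comp q) W := by
  induction W using envAlg_induction with
  | hgen a p x => rw [envTransport_gen, envTransport_gen, envTransport_gen, PosetPath.comp_assoc]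
  | hadd x y hx hy => simp only [map_add, hx, hy]
  | hmul x y hx hy => simp only [map_mul, hx, hy]

theorem envTransport_homotopy {o o' : K} {q r : PosetPath o o'} (h : q.Homotopic r)
    (W : A.EnvAlg o) : A.envTransport q W = A.envTransport r W := by
  induction W using envAlg_induction with
  | hgen a p x => rw [envTransport_gen, envTransport_gen, gen_homotopy (h.comp_right p)]
  | hadd x y hx hy => simp only [map_add, hx, hy]
  | hmul x y hx hy => simp only [map_mul, hx, hy]

theorem envTransport_trivial {o : K} (W : A.EnvAlg o) :
    A.envTransport (PosetPath.trivial o) W = W := by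
  induction W using envAlg_induction with
  | hgen a p x => rw [envTransport_gen, gen_homotopy p.trivial_comp]
  | hadd x y hx hy => simp only [map_add, hx, hy]
  | hmul x y hx hy => simp only [map_mul, hx, hy]

/-- The inclusion maps `(p, x) ↦ ((o' o) * p, x)` of the net of ⋆-algebras `EnvAlg`. -/
def envIncl {o o' : K} (h : o ≤ o') : A.EnvAlg o →⋆ₐ[ℂ] A.EnvAlg o' :=
  A.envTransport (.single (.nerve h))

/-- The inverse of `envIncl`. -/
def envInclInv {o o' : K} (h : o ≤ o') : A.EnvAlg o' →⋆ₐ[ℂ] A.EnvAlg o :=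
  A.envTransport (.single (PosetSimplexOne.nerve h).opposite)

theorem envInclInv_envIncl {o o' : K} (h : o ≤ o') (W : A.EnvAlg o) :
    A.envInclInv h (A.envIncl h W) = W := by
  unfold envInclInv envIncl
  rw [envTransport_comp, envTransport_homotopy A (PosetPath.opposite_comp_nerve h),
    envTransport_trivial]

theorem envIncl_envInclInv {o o' : K} (h : o ≤ o') (W : A.EnvAlg o') :
    A.envIncl h (A.envInclInv h W) = W := by
  unfold envInclInv envIncl
  rw [envTransport_comp, envTransport_homotopy A (PosetPath.nerve_comp_opposite h),
    envTransport_trivial]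

theorem envIncl_envIncl {e a o : K} (h₁ : e ≤ a) (h₂ : a ≤ o) (W : A.EnvAlg e) :
    A.envIncl h₂ (A.envIncl h₁ W) = A.envIncl (h₁.trans h₂) W := by
  unfold envIncl
  rw [envTransport_comp, envTransport_homotopy A (PosetPath.nerve_comp_nerve h₁ h₂)]

/-- Morphisms from the net of ⋆-algebras `EnvAlg` into C⋆-net bundles over `K`. -/
structure EnvMorphism where
  target : CStarNet.{u, max u v} K
  isNetBundle : target.IsNetBundle
  map : ∀ o, A.EnvAlg o →⋆ₙₐ[ℂ] target.fiber o
  map_incl : ∀ {o o' : K} (h : o ≤ o') (W : A.EnvAlg o),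
    map o' (A.envIncl h W) = target.incl h (map o W)

theorem EnvMorphism.norm_gen_le (π : A.EnvMorphism) {a o : K} (p : PosetPath a o)
    (x : A.fiber a) : ‖π.map o (A.gen p x)‖ ≤ ‖x‖ := by
  let φ : A.fiber a →⋆ₙₐ[ℂ] π.target.fiber o :=
    { toFun := fun x => π.map o (A.gen p x)
      map_smul' := fun c x => by rw [gen_smul, map_smul]; rfl
      map_zero' := by rw [gen_zero, map_zero]
      map_add' := fun x y => by rw [gen_add, map_add]
      map_mul' := fun x y => by rw [gen_mul, map_mul]
      map_star' := fun x => by rw [← star_gen, map_star] }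
  exact NonUnitalStarAlgHom.norm_apply_le φ x

theorem bddAbove_envNorm {o : K} (W : A.EnvAlg o) :
    BddAbove (Set.range fun π : A.EnvMorphism => ‖π.map o W‖) := by
  induction W using envAlg_induction with
  | hgen a p x => exact ⟨‖x‖, by rintro _ ⟨π, rfl⟩; exact π.norm_gen_le A p x⟩
  | hadd x y hx hy =>
    obtain ⟨c, hc⟩ := hx
    obtain ⟨d, hd⟩ := hy
    refine ⟨c + d, ?_⟩
    rintro _ ⟨π, rfl⟩
    dsimp only
    rw [map_add]
    exact (norm_add_le _ _).trans (add_le_add (hc ⟨π, rfl⟩) (hd ⟨π, rfl⟩))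
  | hmul x y hx hy =>
    obtain ⟨c, hc⟩ := hx
    obtain ⟨d, hd⟩ := hy
    refine ⟨c * d, ?_⟩
    rintro _ ⟨π, rfl⟩
    dsimp only
    rw [map_mul]
    have h₁ : ‖π.map o x‖ ≤ c := hc ⟨π, rfl⟩
    exact (norm_mul_le _ _).trans (mul_le_mul h₁ (hd ⟨π, rfl⟩) (norm_nonneg _)
      ((norm_nonneg _).trans h₁))

/-- The seminorm `‖W‖ = sup_π ‖π_o(W)‖`, over all morphisms `π` into C⋆-net bundles. -/
def envNorm {o : K} (W : A.EnvAlg o) : ℝ := ⨆ π : A.EnvMorphism, ‖π.map o W‖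

theorem le_envNorm {o : K} (π : A.EnvMorphism) (W : A.EnvAlg o) : ‖π.map o W‖ ≤ A.envNorm W :=
  le_ciSup (A.bddAbove_envNorm W) π

theorem envNorm_nonneg {o : K} (W : A.EnvAlg o) : 0 ≤ A.envNorm W :=
  Real.iSup_nonneg fun _ => norm_nonneg _

theorem envNorm_le {o : K} (W : A.EnvAlg o) {c : ℝ} (hc : 0 ≤ c)
    (h : ∀ π : A.EnvMorphism, ‖π.map o W‖ ≤ c) : A.envNorm W ≤ c :=
  Real.iSup_le h hc

theorem envNorm_envIncl {o o' : K} (h : o ≤ o') (W : A.EnvAlg o) :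
    A.envNorm (A.envIncl h W) = A.envNorm W := by
  unfold envNorm
  congr 1
  funext π
  rw [π.map_incl]
  exact NonUnitalStarAlgHom.norm_map _ (π.target.incl_injective h) _

/-- `envNorm` as a ring seminorm. -/
def envSeminorm (o : K) : RingSeminorm (A.EnvAlg o) where
  toFun := A.envNorm
  map_zero' := by simp [envNorm]
  add_le' x y := A.envNorm_le _ (add_nonneg (A.envNorm_nonneg x) (A.envNorm_nonneg y)) fun π => by
    rw [map_add]
    exact (norm_add_le _ _).trans (add_le_add (A.le_envNorm π x) (A.le_envNorm π y))
  neg' x := by simp [envNorm]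
  mul_le' x y := A.envNorm_le _ (mul_nonneg (A.envNorm_nonneg x) (A.envNorm_nonneg y)) fun π => by
    rw [map_mul]
    exact (norm_mul_le _ _).trans (mul_le_mul (A.le_envNorm π x) (A.le_envNorm π y)
      (norm_nonneg _) (A.envNorm_nonneg x))

instance (o : K) : SeminormedRing (A.EnvAlg o) := (A.envSeminorm o).toSeminormedRing

theorem env_norm_def {o : K} (W : A.EnvAlg o) : ‖W‖ = A.envNorm W := rfl

instance (o : K) : NormedAlgebra ℂ (A.EnvAlg o) where
  norm_smul_le c W := A.envNorm_le _ (mul_nonneg (norm_nonneg c) (A.envNorm_nonneg W)) fun π => by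
    rw [map_smul, norm_smul]
    exact mul_le_mul_of_nonneg_left (A.le_envNorm π W) (norm_nonneg c)

instance (o : K) : NormedStarGroup (A.EnvAlg o) where
  norm_star_le W := A.envNorm_le _ (A.envNorm_nonneg W) fun π => by
    rw [map_star, norm_star]
    exact A.le_envNorm π W

theorem env_norm_mul_self_le {o : K} (W : A.EnvAlg o) : ‖W‖ * ‖W‖ ≤ ‖star W * W‖ := by
  have h : ‖W‖ ≤ √‖star W * W‖ := A.envNorm_le _ (Real.sqrt_nonneg _) fun π => by
    apply Real.le_sqrt_of_sq_le
    rw [pow_two, ← CStarRing.norm_star_mul_self, ← map_star, ← map_mul]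
    exact A.le_envNorm π _
  calc ‖W‖ * ‖W‖ ≤ √‖star W * W‖ * √‖star W * W‖ :=
        mul_le_mul h h (norm_nonneg _) (Real.sqrt_nonneg _)
    _ = ‖star W * W‖ := Real.mul_self_sqrt (norm_nonneg _)

/-- The fibre of the enveloping net bundle: the completion of the quotient of `EnvAlg` by the
null elements of the seminorm. -/
def EnvFiber (o : K) : Type (max u v) := UniformSpace.Completion (A.EnvAlg o)

instance (o : K) : NormedRing (A.EnvFiber o) :=
  inferInstanceAs (NormedRing (UniformSpace.Completion (A.EnvAlg o)))

instance (o : K) : CompleteSpace (A.EnvFiber o) :=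
  inferInstanceAs (CompleteSpace (UniformSpace.Completion (A.EnvAlg o)))

instance (o : K) : Algebra ℂ (A.EnvFiber o) :=
  inferInstanceAs (Algebra ℂ (UniformSpace.Completion (A.EnvAlg o)))

instance (o : K) : NormedAlgebra ℂ (A.EnvFiber o) where
  norm_smul_le c x := norm_smul_le (β := UniformSpace.Completion (A.EnvAlg o)) c x

/-- The canonical map of `EnvAlg` into its completion. -/
def toEnvFiber (o : K) : A.EnvAlg o →ₐ[ℂ] A.EnvFiber o :=
  { UniformSpace.Completion.coeRingHom (α := A.EnvAlg o) with
    commutes' := fun _ => rfl }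

theorem norm_toEnvFiber {o : K} (W : A.EnvAlg o) : ‖A.toEnvFiber o W‖ = ‖W‖ :=
  UniformSpace.Completion.norm_coe W

theorem denseRange_toEnvFiber (o : K) : DenseRange (A.toEnvFiber o) :=
  UniformSpace.Completion.denseRange_coe

theorem envFiber_induction {o : K} {C : A.EnvFiber o → Prop} (hC : IsClosed {x | C x})
    (h : ∀ W, C (A.toEnvFiber o W)) (x : A.EnvFiber o) : C x :=
  UniformSpace.Completion.induction_on (α := A.EnvAlg o) x hC h

/-- The adjoint extends to the completion by continuity. -/
instance (o : K) : Star (A.EnvFiber o) :=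
  ⟨fun x => UniformSpace.Completion.map (α := A.EnvAlg o) star x⟩

theorem star_toEnvFiber {o : K} (W : A.EnvAlg o) :
    star (A.toEnvFiber o W) = A.toEnvFiber o (star W) :=
  UniformSpace.Completion.map_coe (star_isometry (E := A.EnvAlg o)).uniformContinuous W

instance (o : K) : ContinuousStar (A.EnvFiber o) :=
  ⟨UniformSpace.Completion.continuous_map (α := A.EnvAlg o) (f := star)⟩

theorem envFiber_star_star {o : K} (x : A.EnvFiber o) : star (star x) = x := by
  induction x using envFiber_induction with
  | hC => exact isClosed_eq (continuous_star.comp continuous_star) continuous_id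
  | h V => rw [star_toEnvFiber, star_toEnvFiber, star_star]

theorem envFiber_star_add {o : K} (x y : A.EnvFiber o) : star (x + y) = star x + star y := by
  induction x using envFiber_induction with
  | hC =>
    exact isClosed_eq (continuous_star.comp (continuous_id.add continuous_const))
      (continuous_star.add continuous_const)
  | h V =>
    induction y using envFiber_induction with
    | hC =>
      exact isClosed_eq (continuous_star.comp (continuous_const.add continuous_id))
        (continuous_const.add continuous_star)
    | h W => rw [← map_add, star_toEnvFiber, star_toEnvFiber, star_toEnvFiber, star_add, map_add]

theorem envFiber_star_mul {o : K} (x y : A.EnvFiber o) : star (x * y) = star y * star x := by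
  induction x using envFiber_induction with
  | hC =>
    exact isClosed_eq (continuous_star.comp (continuous_id.mul continuous_const))
      (continuous_const.mul continuous_star)
  | h V =>
    induction y using envFiber_induction with
    | hC =>
      exact isClosed_eq (continuous_star.comp (continuous_const.mul continuous_id))
        (continuous_star.mul continuous_const)
    | h W => rw [← map_mul, star_toEnvFiber, star_toEnvFiber, star_toEnvFiber, star_mul, map_mul]

instance (o : K) : StarRing (A.EnvFiber o) where
  star_involutive := A.envFiber_star_star
  star_add := A.envFiber_star_add
  star_mul := A.envFiber_star_mul

theorem envFiber_star_smul {o : K} (c : ℂ) (x : A.EnvFiber o) :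
    star (c • x) = star c • star x := by
  induction x using envFiber_induction with
  | hC =>
    exact isClosed_eq (continuous_star.comp (continuous_id.const_smul c))
      (continuous_star.const_smul (star c))
  | h V => rw [← map_smul, star_toEnvFiber, star_toEnvFiber, star_smul, map_smul]

instance (o : K) : StarModule ℂ (A.EnvFiber o) := ⟨A.envFiber_star_smul⟩

instance (o : K) : CStarRing (A.EnvFiber o) where
  norm_mul_self_le x := by
    induction x using envFiber_induction with
    | hC => exact isClosed_le (by fun_prop) (by fun_prop)
    | h V =>
      rw [star_toEnvFiber, ← map_mul, norm_toEnvFiber, norm_toEnvFiber]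
      exact A.env_norm_mul_self_le V

instance (o : K) : CStarAlgebra (A.EnvFiber o) where

/-- Norm preserving ⋆-morphisms extend by continuity to the completions (as ring morphisms). -/
def envExtendRingHom {o o' : K} (f : A.EnvAlg o →⋆ₐ[ℂ] A.EnvAlg o') (hf : ∀ W, ‖f W‖ = ‖W‖) :
    A.EnvFiber o →+* A.EnvFiber o' :=
  UniformSpace.Completion.mapRingHom (f : A.EnvAlg o →+* A.EnvAlg o')
    (AddMonoidHomClass.isometry_of_norm f hf).continuous

theorem envExtendRingHom_coe {o o' : K} (f : A.EnvAlg o →⋆ₐ[ℂ] A.EnvAlg o')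
    (hf : ∀ W, ‖f W‖ = ‖W‖) (W : A.EnvAlg o) :
    A.envExtendRingHom f hf (A.toEnvFiber o W) = A.toEnvFiber o' (f W) :=
  UniformSpace.Completion.mapRingHom_coe
    (f := (f : A.EnvAlg o →+* A.EnvAlg o')) (AddMonoidHomClass.isometry_of_norm f hf).continuous W

theorem continuous_envExtendRingHom {o o' : K} (f : A.EnvAlg o →⋆ₐ[ℂ] A.EnvAlg o')
    (hf : ∀ W, ‖f W‖ = ‖W‖) : Continuous (A.envExtendRingHom f hf) :=
  UniformSpace.Completion.continuous_map

/-- Norm preserving ⋆-morphisms extend by continuity to the completions. -/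
def envExtend {o o' : K} (f : A.EnvAlg o →⋆ₐ[ℂ] A.EnvAlg o') (hf : ∀ W, ‖f W‖ = ‖W‖) :
    A.EnvFiber o →⋆ₐ[ℂ] A.EnvFiber o' :=
  { A.envExtendRingHom f hf with
    commutes' := fun c => by
      change A.envExtendRingHom f hf (algebraMap ℂ (A.EnvFiber o) c) = _
      rw [← AlgHom.commutes (A.toEnvFiber o), envExtendRingHom_coe, AlgHomClass.commutes,
        AlgHomClass.commutes]
    map_star' := fun x => by
      change A.envExtendRingHom f hf (star x) = star (A.envExtendRingHom f hf x)
      induction x using envFiber_induction with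
      | hC =>
        exact isClosed_eq ((A.continuous_envExtendRingHom f hf).comp continuous_star)
          (continuous_star.comp (A.continuous_envExtendRingHom f hf))
      | h V => rw [star_toEnvFiber, envExtendRingHom_coe, envExtendRingHom_coe, star_toEnvFiber,
          map_star] }

theorem envExtend_coe {o o' : K} (f : A.EnvAlg o →⋆ₐ[ℂ] A.EnvAlg o') (hf : ∀ W, ‖f W‖ = ‖W‖)
    (W : A.EnvAlg o) : A.envExtend f hf (A.toEnvFiber o W) = A.toEnvFiber o' (f W) :=
  A.envExtendRingHom_coe f hf W

theorem continuous_envExtend {o o' : K} (f : A.EnvAlg o →⋆ₐ[ℂ] A.EnvAlg o')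
    (hf : ∀ W, ‖f W‖ = ‖W‖) : Continuous (A.envExtend f hf) :=
  A.continuous_envExtendRingHom f hf

theorem norm_envIncl {o o' : K} (h : o ≤ o') (W : A.EnvAlg o) : ‖A.envIncl h W‖ = ‖W‖ :=
  A.envNorm_envIncl h W

theorem norm_envInclInv {o o' : K} (h : o ≤ o') (W : A.EnvAlg o') :
    ‖A.envInclInv h W‖ = ‖W‖ := by
  rw [← A.norm_envIncl h, envIncl_envInclInv]

theorem envExtend_inv {o o' : K} (f : A.EnvAlg o →⋆ₐ[ℂ] A.EnvAlg o')
    (g : A.EnvAlg o' →⋆ₐ[ℂ] A.EnvAlg o) (hf : ∀ W, ‖f W‖ = ‖W‖) (hg : ∀ W, ‖g W‖ = ‖W‖)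
    (h : ∀ W, g (f W) = W) (x : A.EnvFiber o) : A.envExtend g hg (A.envExtend f hf x) = x := by
  induction x using envFiber_induction with
  | hC =>
    exact isClosed_eq ((A.continuous_envExtend g hg).comp (A.continuous_envExtend f hf))
      continuous_id
  | h V => rw [envExtend_coe, envExtend_coe, h]

theorem envExtend_envIncl_bijective {o o' : K} (h : o ≤ o') :
    Function.Bijective (A.envExtend (A.envIncl h) (A.norm_envIncl h)) :=
  Function.bijective_iff_has_inverse.2 ⟨A.envExtend (A.envInclInv h) (A.norm_envInclInv h),
    A.envExtend_inv _ _ _ _ (A.envInclInv_envIncl h),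
    A.envExtend_inv _ _ _ _ (A.envIncl_envInclInv h)⟩

/-- The enveloping net bundle of the net `A`. -/
def enveloping : CStarNet.{u, max u v} K where
  fiber := A.EnvFiber
  incl h := A.envExtend (A.envIncl h) (A.norm_envIncl h)
  incl_injective h := (A.envExtend_envIncl_bijective h).1
  incl_incl h₁ h₂ x := by
    induction x using envFiber_induction with
    | hC =>
      exact isClosed_eq ((A.continuous_envExtend _ _).comp (A.continuous_envExtend _ _))
        (A.continuous_envExtend _ _)
    | h V => rw [envExtend_coe, envExtend_coe, envExtend_coe, envIncl_envIncl]

theorem enveloping_isNetBundle : A.enveloping.IsNetBundle :=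
  fun h => A.envExtend_envIncl_bijective h

/-- The canonical embedding `x ↦ (ι_o, x)` of the net into its enveloping net bundle. -/
def canonicalEmbedding : Morphism A A.enveloping where
  map o :=
    { toFun := fun x => A.toEnvFiber o (A.gen (PosetPath.trivial o) x)
      map_smul' := fun c x => by rw [gen_smul, map_smul]; rfl
      map_zero' := by rw [gen_zero, map_zero]; rfl
      map_add' := fun x y => by rw [gen_add, map_add]; rfl
      map_mul' := fun x y => by rw [gen_mul, map_mul]; rfl
      map_star' := fun x => by rw [← star_gen, ← star_toEnvFiber]; rfl }
  map_incl {a o} h x := by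
    change A.toEnvFiber o (A.gen (PosetPath.trivial o) (A.incl h x)) =
      A.envExtend (A.envIncl h) (A.norm_envIncl h)
        (A.toEnvFiber a (A.gen (PosetPath.trivial a) x))
    rw [envExtend_coe, gen_isotony]
    unfold envIncl
    rw [envTransport_gen, gen_homotopy (PosetPath.trivial_comp _)]
    exact congrArg _ (gen_homotopy (PosetPath.nerve_comp_nerve le_rfl h) x).symm

/-- A net is degenerate if its enveloping net bundle vanishes. -/
def Degenerate : Prop := A.enveloping.Vanishes

/-- A net is injective if it is nondegenerate and the canonical embedding into its enveloping
net bundle is a monomorphism. -/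
def IsInjective : Prop := ¬ A.Degenerate ∧ A.canonicalEmbedding.IsMono

end CStarNet

/-! ## The generalized Čech cocycle -/

/-- An `n`-simplex `(F; o_{n+1}, …, o_1)` of the symmetric simplicial set `Σ°_*(K)`: a nonempty
subset `F` (the support) each element of which is smaller than each of the `n + 1` vertices.
Here `vertex i` is `o_{i+1}`. -/
structure CechSimplex (K : Type u) [PartialOrder K] (n : ℕ) where
  supp : Set K
  supp_nonempty : supp.Nonempty
  vertex : Fin (n + 1) → K
  le : ∀ a ∈ supp, ∀ i, a ≤ vertex i

namespace CechSimplex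

variable {K : Type u} [PartialOrder K]

/-- Relabel the vertices, keeping the support. -/
def reindex {m n : ℕ} (x : CechSimplex K n) (f : Fin (m + 1) → Fin (n + 1)) : CechSimplex K m :=
  ⟨x.supp, x.supp_nonempty, fun i => x.vertex (f i), fun a ha i => x.le a ha (f i)⟩

/-- The face `∂ᵢ`: omit the vertex `i`. -/
def face {n : ℕ} (i : Fin (n + 2)) (x : CechSimplex K (n + 1)) : CechSimplex K n :=
  x.reindex i.succAbove

/-- The degeneracy `σᵢ`: repeat the vertex `i`. -/
def degeneracy {n : ℕ} (i : Fin (n + 1)) (x : CechSimplex K n) : CechSimplex K (n + 1) :=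
  x.reindex i.predAbove

/-- Permute the vertices. -/
def permute {n : ℕ} (σ : Equiv.Perm (Fin (n + 1))) (x : CechSimplex K n) : CechSimplex K n :=
  x.reindex σ

end CechSimplex

/-- Symmetric subsimplicial sets of `Σ°_*(K)`. -/
structure CechSub (K : Type u) [PartialOrder K] where
  simplices : ∀ n : ℕ, Set (CechSimplex K n)
  face_mem : ∀ {n : ℕ} (i : Fin (n + 2)) {x : CechSimplex K (n + 1)},
    x ∈ simplices (n + 1) → x.face i ∈ simplices n
  degeneracy_mem : ∀ {n : ℕ} (i : Fin (n + 1)) {x : CechSimplex K n},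
    x ∈ simplices n → x.degeneracy i ∈ simplices (n + 1)
  permute_mem : ∀ {n : ℕ} (σ : Equiv.Perm (Fin (n + 1))) {x : CechSimplex K n},
    x ∈ simplices n → x.permute σ ∈ simplices n

/-- Inclusion of symmetric subsimplicial sets. -/
instance (K : Type u) [PartialOrder K] : LE (CechSub K) :=
  ⟨fun D E => ∀ n, D.simplices n ⊆ E.simplices n⟩

/-- `Σ°_*(P)` as a symmetric subsimplicial set of `Σ°_*(K)`: the simplices whose support is a
subset of `P` and whose vertices are elements of `P`. -/
def CechSub.ofSubset {K : Type u} [PartialOrder K] (P : Set K) : CechSub K where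
  simplices _ := {x | x.supp ⊆ P ∧ ∀ i, x.vertex i ∈ P}
  face_mem _ _ hx := ⟨hx.1, fun _ => hx.2 _⟩
  degeneracy_mem _ _ hx := ⟨hx.1, fun _ => hx.2 _⟩
  permute_mem _ _ hx := ⟨hx.1, fun _ => hx.2 _⟩

namespace CStarNet

variable {K : Type u} [PartialOrder K] (A : CStarNet.{u, v} K)

/-- The C⋆-subalgebra of the fibre over `o` generated by the images of the fibres over the
elements of `F`, for `F ≤ o`. -/
def suppAlgebra (F : Set K) (o : K) (hF : ∀ a ∈ F, a ≤ o) : StarSubalgebra ℂ (A.fiber o) :=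
  (StarAlgebra.adjoin ℂ
    {y | ∃ (a : K) (ha : a ∈ F) (x : A.fiber a), A.incl (hF a ha) x = y}).topologicalClosure

theorem incl_mem_suppAlgebra {F : Set K} {o : K} (hF : ∀ a ∈ F, a ≤ o) {a : K} (ha : a ∈ F)
    (x : A.fiber a) : A.incl (hF a ha) x ∈ A.suppAlgebra F o hF :=
  StarSubalgebra.le_topologicalClosure _ (StarAlgebra.subset_adjoin ℂ _ ⟨a, ha, x, rfl⟩)

/-- The C⋆-algebra attached to a 1-simplex at its vertex `i`. -/
abbrev vertexAlgebra (x : CechSimplex K 1) (i : Fin 2) : StarSubalgebra ℂ (A.fiber (x.vertex i)) :=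
  A.suppAlgebra x.supp (x.vertex i) (fun a ha => x.le a ha i)

/-- A generalized Čech cocycle of the net `A` defined over `D`: ⋆-isomorphisms
`ζ^F_{o₂ o₁}`, for `(F; o₂, o₁)` in `D₁`, with `ζ^F_{o₂ o₁} ∘ j_{o₁ a} = j_{o₂ a}` for `a ∈ F`. -/
structure CechCocycle (D : CechSub K) where
  ζ : ∀ x ∈ D.simplices 1, A.vertexAlgebra x 0 ≃⋆ₐ[ℂ] A.vertexAlgebra x 1
  ζ_incl : ∀ (x : CechSimplex K 1) (hx : x ∈ D.simplices 1) (a : K) (ha : a ∈ x.supp)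
    (y : A.fiber a),
    ζ x hx ⟨A.incl (x.le a ha 0) y, A.incl_mem_suppAlgebra _ ha y⟩ =
      ⟨A.incl (x.le a ha 1) y, A.incl_mem_suppAlgebra _ ha y⟩

/-- The domain of the Čech cocycle: the union of all symmetric subsimplicial sets over which a
Čech cocycle is defined. -/
def cechDomain : CechSub K where
  simplices n := {x | ∃ D : CechSub K, Nonempty (A.CechCocycle D) ∧ x ∈ D.simplices n}
  face_mem i _ := fun ⟨D, hD, hx⟩ => ⟨D, hD, D.face_mem i hx⟩
  degeneracy_mem i _ := fun ⟨D, hD, hx⟩ => ⟨D, hD, D.degeneracy_mem i hx⟩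
  permute_mem σ _ := fun ⟨D, hD, hx⟩ => ⟨D, hD, D.permute_mem σ hx⟩

/-- The domain is the largest symmetric subsimplicial set over which a Čech cocycle is defined. -/
theorem cechDomain_isGreatest :
    Nonempty (A.CechCocycle A.cechDomain) ∧
      ∀ D : CechSub K, Nonempty (A.CechCocycle D) → D ≤ A.cechDomain := by
  refine ⟨⟨⟨fun x hx => hx.choose_spec.1.some.ζ x hx.choose_spec.2, fun x hx a ha y =>
    hx.choose_spec.1.some.ζ_incl x hx.choose_spec.2 a ha y⟩⟩, fun D hD n x hx => ⟨D, hD, hx⟩⟩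

end CStarNet

end

/-! A Čech cocycle consists of one ⋆-isomorphism per 1-simplex, with conditions that involve this
simplex alone, so the isomorphisms may be found separately for each simplex. Let `F` be the support,
and `o`, `o'` the vertices. It suffices to have a C⋆-algebra `C` and faithful morphisms `φ₁`, `φ₂`
of the fibres over `o`, `o'` into `C` under which the two copies of the fibre over each `a ∈ F`
coincide. Faithful morphisms of C⋆-algebras are isometric, so they send the closed subalgebras
generated by these copies onto the same subalgebra of `C`, and `φ₂⁻¹ ∘ φ₁` is the isomorphism. This
reduction is `exists_suppAlgebra_equiv` and `le_cechDomain_of_forall_exists`.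

For a net over `P` with a faithful Hilbert space representation, `C` is the algebra of bounded
operators and `φ₁`, `φ₂` are the given representations.

For an injective net, `C` is the fibre over `o'` of the enveloping net bundle and `φ₂` is the
canonical embedding. The morphism `φ₁` is the canonical embedding over `o` followed by transport
along a path `p : o → o'` in `P`, which is isometric (`norm_envTransport`). On an element `x` over
`a ∈ F` the two morphisms give the symbols `(p * (oa), x)` and `((o'a), x)`. These agree once `p *
(oa) ∼ (o'a)`, and this holds because a loop over `a` in `P` is contractible
(`comp_nerve_homotopic_of_simplyConnected`). -/

/-! ### Closed subalgebras with matching generators -/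

/-- If two injective ⋆-morphisms into the same C⋆-algebra match the generators of two closed
subalgebras, then every element of the first one has a counterpart in the second one. -/
theorem StarSubalgebra.exists_mem_topologicalClosure_adjoin_map_eq {ι B₁ B₂ C : Type*}
    [CStarAlgebra B₁] [CStarAlgebra B₂] [CStarAlgebra C]
    (φ₁ : B₁ →⋆ₙₐ[ℂ] C) (φ₂ : B₂ →⋆ₙₐ[ℂ] C) (h₂ : Function.Injective φ₂)
    {y : ι → B₁} {z : ι → B₂} (hyz : ∀ i, φ₁ (y i) = φ₂ (z i)) (hone : φ₁ 1 = φ₂ 1) {x : B₁}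
    (hx : x ∈ (StarAlgebra.adjoin ℂ (Set.range y)).topologicalClosure) :
    ∃ w ∈ (StarAlgebra.adjoin ℂ (Set.range z)).topologicalClosure, φ₁ x = φ₂ w := by
  set S := (StarAlgebra.adjoin ℂ (Set.range z)).topologicalClosure with hS
  -- The isometry `φ₂` maps the closed set `S` onto a closed set, and the contraction `φ₁` is
  -- continuous. It is therefore enough to treat the dense algebraic span of the generators.
  have hclosed : IsClosed (φ₁ ⁻¹' (φ₂ '' (S : Set B₂))) :=
    (((NonUnitalStarAlgHom.isometry φ₂ h₂).isClosedEmbedding.isClosedMap _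
      (StarSubalgebra.isClosed_topologicalClosure _))).preimage
        (AddMonoidHomClass.continuous_of_bound φ₁ 1 fun x => by
          simpa only [one_mul] using NonUnitalStarAlgHom.norm_apply_le φ₁ x)
  have hsub : (StarAlgebra.adjoin ℂ (Set.range y) : Set B₁) ⊆ φ₁ ⁻¹' (φ₂ '' (S : Set B₂)) := by
    intro x hx
    induction hx using StarAlgebra.adjoin_induction with
    | mem x hx =>
      obtain ⟨i, rfl⟩ := hx
      exact ⟨z i, StarSubalgebra.le_topologicalClosure _
        (StarAlgebra.subset_adjoin ℂ _ ⟨i, rfl⟩), (hyz i).symm⟩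
    | algebraMap r =>
      refine ⟨algebraMap ℂ B₂ r, S.algebraMap_mem r, ?_⟩
      -- The morphisms need not be unital, so scalars match only because the images of the two units
      -- do.
      rw [Algebra.algebraMap_eq_smul_one, Algebra.algebraMap_eq_smul_one, map_smul, map_smul, hone]
    | add x x' _ _ hx hx' =>
      obtain ⟨w, hw, e⟩ := hx
      obtain ⟨w', hw', e'⟩ := hx'
      exact ⟨w + w', add_mem hw hw', by rw [map_add, map_add, e, e']⟩
    | mul x x' _ _ hx hx' =>
      obtain ⟨w, hw, e⟩ := hx
      obtain ⟨w', hw', e'⟩ := hx'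
      exact ⟨w * w', mul_mem hw hw', by rw [map_mul, map_mul, e, e']⟩
    | star x _ hx =>
      obtain ⟨w, hw, e⟩ := hx
      exact ⟨star w, star_mem hw, by rw [map_star, map_star, e]⟩
  obtain ⟨w, hw, e⟩ := closure_minimal hsub hclosed hx
  exact ⟨w, hw, e.symm⟩

/-- Injective ⋆-morphisms into the same C⋆-algebra which match the elements of two subalgebras
induce a ⋆-isomorphism of these subalgebras. -/
theorem StarSubalgebra.exists_starAlgEquiv_of_map_eq {B₁ B₂ C : Type*}
    [CStarAlgebra B₁] [CStarAlgebra B₂] [CStarAlgebra C]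
    (φ₁ : B₁ →⋆ₙₐ[ℂ] C) (φ₂ : B₂ →⋆ₙₐ[ℂ] C) (h₁ : Function.Injective φ₁)
    (h₂ : Function.Injective φ₂) (S₁ : StarSubalgebra ℂ B₁) (S₂ : StarSubalgebra ℂ B₂)
    (h₁₂ : ∀ x ∈ S₁, ∃ w ∈ S₂, φ₁ x = φ₂ w) (h₂₁ : ∀ w ∈ S₂, ∃ x ∈ S₁, φ₂ w = φ₁ x) :
    ∃ e : S₁ ≃⋆ₐ[ℂ] S₂, ∀ x, φ₂ (e x) = φ₁ x := by
  -- By injectivity the counterparts are unique. Hence the chosen maps are mutually inverse and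
  -- respect all operations: each identity is checked after applying `φ₁` or `φ₂`.
  choose f hf hfe using h₁₂
  choose g hg hge using h₂₁
  refine ⟨{ toFun := fun x => ⟨f x x.2, hf x x.2⟩
            invFun := fun w => ⟨g w w.2, hg w w.2⟩
            left_inv := fun x => Subtype.ext (h₁ ?_)
            right_inv := fun w => Subtype.ext (h₂ ?_)
            map_mul' := fun x x' => Subtype.ext (h₂ ?_)
            map_add' := fun x x' => Subtype.ext (h₂ ?_)
            map_star' := fun x => Subtype.ext (h₂ ?_)
            map_smul' := fun c x => Subtype.ext (h₂ ?_) }, fun x => (hfe x x.2).symm⟩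
  · exact (hge _ _).symm.trans (hfe _ _).symm
  · exact (hfe _ _).symm.trans (hge _ _).symm
  · change φ₂ (f (x * x') _) = φ₂ (f x _ * f x' _)
    rw [map_mul, ← hfe, ← hfe, ← hfe, map_mul]
  · change φ₂ (f (x + x') _) = φ₂ (f x _ + f x' _)
    rw [map_add, ← hfe, ← hfe, ← hfe, map_add]
  · change φ₂ (f (star (x : B₁)) _) = φ₂ (star (f x _))
    rw [map_star, ← hfe, ← hfe, map_star]
  · change φ₂ (f (c • (x : B₁)) _) = φ₂ (c • f x _)
    rw [map_smul, ← hfe, ← hfe, map_smul]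

/-! ### Paths in a subset and simple connectedness -/

namespace PosetPath

variable {K : Type u} [PartialOrder K]

/-- A 1-simplex is homotopic to the path which passes through its support. -/
theorem single_homotopic {a o : K} (b : PosetSimplexOne a o) :
    Homotopic (comp (single (PosetSimplexOne.nerve b.le_target).opposite)
      (single (.nerve b.le_source))) (single b) :=
  .rel _ _ (.face ⟨b.supp, (PosetSimplexOne.nerve b.le_target).opposite, b,
    .nerve b.le_source, le_rfl, le_rfl, le_rfl⟩)

/-- The image in `K` of a path in a subset. -/
def ofSubtype {P : Set K} : {a o : P} → PosetPath a o → PosetPath (a : K) (o : K)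
  | _, _, single b => single ⟨b.supp, b.le_source, b.le_target⟩
  | _, _, cons b p => cons ⟨b.supp, b.le_source, b.le_target⟩ (ofSubtype p)

theorem ofSubtype_comp {P : Set K} {a e o : P} (q : PosetPath e o) (p : PosetPath a e) :
    ofSubtype (comp q p) = comp (ofSubtype q) (ofSubtype p) := by
  induction q with
  | single b => simp only [comp, ofSubtype]
  | cons b q ih => simp only [comp, ofSubtype, ih]

/-- A 2-simplex of `P` is a 2-simplex of `K` with the same supports. Homotopies in `P` are thus
homotopies in `K`, which lets contractibility in `P` be used although the symbols of the enveloping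
bundle involve paths in `K`. -/
theorem Deform.ofSubtype {P : Set K} {a o : P} {p q : PosetPath a o} (h : Deform p q) :
    Deform (ofSubtype p) (ofSubtype q) := by
  induction h with
  | @face a e o c =>
    simp only [ofSubtype_comp, PosetPath.ofSubtype]
    exact .face (a := (a : K)) (e := (e : K)) (o := (o : K)) ⟨c.supp, ⟨c.face₀.supp, c.face₀.le_source, c.face₀.le_target⟩,
      ⟨c.face₁.supp, c.face₁.le_source, c.face₁.le_target⟩,
      ⟨c.face₂.supp, c.face₂.le_source, c.face₂.le_target⟩, c.le₀, c.le₁, c.le₂⟩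
  | right r _ ih => rw [ofSubtype_comp, ofSubtype_comp]; exact .right _ ih
  | left r _ ih => rw [ofSubtype_comp, ofSubtype_comp]; exact .left _ ih

theorem Homotopic.ofSubtype {P : Set K} {a o : P} {p q : PosetPath a o} (h : Homotopic p q) :
    Homotopic (ofSubtype p) (ofSubtype q) := by
  induction h with
  | rel x y h => exact .rel _ _ h.ofSubtype
  | refl x => exact .refl _
  | symm x y _ ih => exact .symm _ _ ih
  | trans x y z _ _ ih₁ ih₂ => exact .trans _ _ _ ih₁ ih₂

theorem comp_trivial_nerve {a o : K} (h : a ≤ o) :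
    Homotopic (comp (single (.nerve h)) (trivial a)) (single (.nerve h)) :=
  nerve_comp_nerve le_rfl h

/-- In a simply connected poset, a path between two upper bounds of `a` intertwines the
inclusions of `a`. -/
theorem comp_nerve_homotopic_of_simplyConnected (hK : PosetSimplyConnected K) {a o o' : K}
    (h : a ≤ o) (h' : a ≤ o') (p : PosetPath o o') :
    Homotopic (comp p (single (.nerve h))) (single (.nerve h')) := by
  -- The loop over `a` climbs to `o`, follows `p` to `o'` and descends to `a`. It is contractible,
  -- and composing with the 1-simplex `(o'a)` brings its end back to `o'`.
  have h₁ := (hK a (comp (single (PosetSimplexOne.nerve h').opposite)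
    (comp p (single (.nerve h))))).comp_left (single (.nerve h'))
  rw [← comp_assoc] at h₁
  -- Descending from `o'` to `a` and climbing back is homotopic to the trivial loop over `o'`, so
  -- this detour can be inserted after `p * (oa)`.
  have h₂ := ((nerve_comp_opposite h').comp_right (comp p (single (.nerve h)))).symm
  exact (((trivial_comp _).symm.trans _ _ _ h₂).trans _ _ _ h₁).trans _ _ _ (comp_trivial_nerve h')

end PosetPath

/-! ### From faithful representations to Čech cocycles -/

namespace CStarNet

variable {K : Type u} [PartialOrder K] (A : CStarNet.{u, v} K)

/-- The index type of the generators does not depend on the upper bound `o`, so the generators over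
two different upper bounds can be paired index by index. -/
theorem suppAlgebra_eq_adjoin_range {F : Set K} {o : K} (hF : ∀ a ∈ F, a ≤ o) :
    A.suppAlgebra F o hF = (StarAlgebra.adjoin ℂ (Set.range fun s : Σ a : F, A.fiber a =>
      A.incl (hF s.1 s.1.2) s.2)).topologicalClosure := by
  unfold suppAlgebra
  congr 2
  ext y
  exact ⟨fun ⟨a, ha, z, hz⟩ => ⟨⟨⟨a, ha⟩, z⟩, hz⟩, fun ⟨s, hs⟩ => ⟨s.1, s.1.2, s.2, hs⟩⟩

variable {A} in
/-- Faithful representations of the fibres over two upper bounds of `F` which agree on the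
elements coming from `F` yield a ⋆-isomorphism between the algebras attached to `F`. -/
theorem exists_suppAlgebra_equiv {F : Set K} (hne : F.Nonempty) {o o' : K}
    (hF : ∀ a ∈ F, a ≤ o) (hF' : ∀ a ∈ F, a ≤ o') {C : Type*} [CStarAlgebra C]
    (φ₁ : A.fiber o →⋆ₙₐ[ℂ] C) (φ₂ : A.fiber o' →⋆ₙₐ[ℂ] C)
    (h₁ : Function.Injective φ₁) (h₂ : Function.Injective φ₂)
    (h : ∀ (a : K) (ha : a ∈ F) (y : A.fiber a),
      φ₁ (A.incl (hF a ha) y) = φ₂ (A.incl (hF' a ha) y)) :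
    ∃ e : A.suppAlgebra F o hF ≃⋆ₐ[ℂ] A.suppAlgebra F o' hF',
      ∀ (a : K) (ha : a ∈ F) (y : A.fiber a),
        e ⟨A.incl (hF a ha) y, A.incl_mem_suppAlgebra _ ha y⟩ =
          ⟨A.incl (hF' a ha) y, A.incl_mem_suppAlgebra _ ha y⟩ := by
  -- The inclusions are unital, so the unit of a fibre over any `a ∈ F` gives both units. This is
  -- where a nonempty support is needed.
  have hone : φ₁ 1 = φ₂ 1 := by
    obtain ⟨a, ha⟩ := hne
    simpa only [map_one] using h a ha 1
  have h₁₂ : ∀ y ∈ A.suppAlgebra F o hF, ∃ w ∈ A.suppAlgebra F o' hF', φ₁ y = φ₂ w := by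
    rw [suppAlgebra_eq_adjoin_range, suppAlgebra_eq_adjoin_range]
    exact fun y hy => StarSubalgebra.exists_mem_topologicalClosure_adjoin_map_eq φ₁ φ₂ h₂
      (y := fun s : Σ a : F, A.fiber a => A.incl (hF s.1 s.1.2) s.2)
      (z := fun s : Σ a : F, A.fiber a => A.incl (hF' s.1 s.1.2) s.2)
      (fun s => h s.1 s.1.2 s.2) hone hy
  have h₂₁ : ∀ w ∈ A.suppAlgebra F o' hF', ∃ y ∈ A.suppAlgebra F o hF, φ₂ w = φ₁ y := by
    rw [suppAlgebra_eq_adjoin_range, suppAlgebra_eq_adjoin_range]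
    exact fun y hy => StarSubalgebra.exists_mem_topologicalClosure_adjoin_map_eq φ₂ φ₁ h₁
      (y := fun s : Σ a : F, A.fiber a => A.incl (hF' s.1 s.1.2) s.2)
      (z := fun s : Σ a : F, A.fiber a => A.incl (hF s.1 s.1.2) s.2)
      (fun s => (h s.1 s.1.2 s.2).symm) hone.symm hy
  obtain ⟨e, he⟩ := StarSubalgebra.exists_starAlgEquiv_of_map_eq φ₁ φ₂ h₁ h₂ _ _ h₁₂ h₂₁
  exact ⟨e, fun a ha y => Subtype.ext (h₂ ((he _).trans (h a ha y)))⟩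

/-- Compatible families of faithful representations of the fibres over the vertices of all
1-simplices of `D` yield a Čech cocycle over `D`. -/
theorem le_cechDomain_of_forall_exists {D : CechSub K}
    (hD : ∀ x ∈ D.simplices 1, ∃ (C : Type w) (_ : CStarAlgebra C)
      (φ₁ : A.fiber (x.vertex 0) →⋆ₙₐ[ℂ] C) (φ₂ : A.fiber (x.vertex 1) →⋆ₙₐ[ℂ] C),
      Function.Injective φ₁ ∧ Function.Injective φ₂ ∧ ∀ (a : K) (ha : a ∈ x.supp) (y : A.fiber a),
        φ₁ (A.incl (x.le a ha 0) y) = φ₂ (A.incl (x.le a ha 1) y)) :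
    D ≤ A.cechDomain := by
  have key : ∀ x ∈ D.simplices 1, ∃ e : A.vertexAlgebra x 0 ≃⋆ₐ[ℂ] A.vertexAlgebra x 1,
      ∀ (a : K) (ha : a ∈ x.supp) (y : A.fiber a),
        e ⟨A.incl (x.le a ha 0) y, A.incl_mem_suppAlgebra _ ha y⟩ =
          ⟨A.incl (x.le a ha 1) y, A.incl_mem_suppAlgebra _ ha y⟩ := by
    intro x hx
    obtain ⟨C, _, φ₁, φ₂, h₁, h₂, h⟩ := hD x hx
    exact exists_suppAlgebra_equiv x.supp_nonempty _ _ φ₁ φ₂ h₁ h₂ h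
  choose ζ hζ using key
  exact A.cechDomain_isGreatest.2 D ⟨⟨ζ, hζ⟩⟩

/-! ### Transport in the enveloping net bundle -/

/-- Transport along paths preserves the norm. -/
theorem norm_envTransport {o o' : K} (q : PosetPath o o') (W : A.EnvAlg o) :
    ‖A.envTransport q W‖ = ‖W‖ := by
  have key : ∀ {o o' : K} (b : PosetSimplexOne o o') (W : A.EnvAlg o),
      ‖A.envTransport (.single b) W‖ = ‖W‖ := by
    intro o o' b W
    -- Up to homotopy `b` climbs to its support and descends again. Transport along it is an
    -- inclusion followed by the inverse of an inclusion, and both preserve the norm.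
    rw [← A.envTransport_homotopy (PosetPath.single_homotopic b), ← envTransport_comp]
    exact (A.norm_envInclInv b.le_target _).trans (A.norm_envIncl b.le_source W)
  induction q with
  | single b => exact key b W
  | cons b q ih =>
    have : PosetPath.cons b q = (PosetPath.single b).comp q := by
      simp only [PosetPath.comp]
    rw [this, ← envTransport_comp, key, ih]

/-- Norm preservation passes from the dense image of `EnvAlg` to the completion, and an isometry is
injective. -/
theorem envExtend_injective {o o' : K} (f : A.EnvAlg o →⋆ₐ[ℂ] A.EnvAlg o')
    (hf : ∀ W, ‖f W‖ = ‖W‖) : Function.Injective (A.envExtend f hf) := by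
  refine (AddMonoidHomClass.isometry_of_norm (A.envExtend f hf) fun x => ?_).injective
  induction x using envFiber_induction with
  | hC => exact isClosed_eq (A.continuous_envExtend f hf).norm continuous_norm
  | h V => rw [envExtend_coe, norm_toEnvFiber, norm_toEnvFiber, hf]

/-- Transport along a path intertwines the canonical embeddings, if the path is compatible with
the inclusions up to homotopy. -/
theorem envExtend_canonicalEmbedding_incl {a o o' : K} (h : a ≤ o) (h' : a ≤ o')
    (p : PosetPath o o')
    (hp : (p.comp (.single (.nerve h))).Homotopic (.single (.nerve h'))) (x : A.fiber a) :
    A.envExtend (A.envTransport p) (A.norm_envTransport p)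
      (A.canonicalEmbedding.map o (A.incl h x)) = A.canonicalEmbedding.map o' (A.incl h' x) := by
  change A.envExtend (A.envTransport p) (A.norm_envTransport p)
      (A.toEnvFiber o (A.gen (PosetPath.trivial o) (A.incl h x))) =
    A.toEnvFiber o' (A.gen (PosetPath.trivial o') (A.incl h' x))
  -- Isotony absorbs the inclusions into the paths, and the trivial loops drop out. What remains is
  -- the comparison of `(p * (oa), x)` with `((o'a), x)`.
  rw [envExtend_coe, gen_isotony, gen_isotony, gen_homotopy (PosetPath.trivial_comp _),
    gen_homotopy (PosetPath.trivial_comp (.single (.nerve h'))), envTransport_gen,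
    gen_homotopy hp]

end CStarNet

/-! ### The two criteria -/

theorem mainTheorem12 {K : Type u} [PartialOrder K] (A : CStarNet.{u, v} K) :
    (∀ P : Set K, PosetConnected P →
      CStarNet.HasFaithfulHilbertSpaceRep.{u, v, w} (A.restrict P) →
        CechSub.ofSubset P ≤ A.cechDomain) ∧
    (A.IsInjective →
      ∀ P : Set K, PosetConnected P → PosetSimplyConnected P →
        CechSub.ofSubset P ≤ A.cechDomain) := by
  refine ⟨fun P _ ⟨H, _, _, _, π, hπ, hπi⟩ => ?_, fun hA P hP hP₁ => ?_⟩
  · refine A.le_cechDomain_of_forall_exists fun x hx => ?_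
    refine ⟨H →L[ℂ] H, inferInstance, π ⟨x.vertex 0, hx.2 0⟩, π ⟨x.vertex 1, hx.2 1⟩,
      hπ _, hπ _, fun a ha y => ?_⟩
    -- Both sides equal the representation of the fibre over `a`, which is available because the
    -- support lies in `P`.
    exact (hπi (a := ⟨a, hx.1 ha⟩) (o := ⟨x.vertex 0, hx.2 0⟩) (x.le a ha 0) y).trans
      (hπi (a := ⟨a, hx.1 ha⟩) (o := ⟨x.vertex 1, hx.2 1⟩) (x.le a ha 1) y).symm
  · refine A.le_cechDomain_of_forall_exists fun x hx => ?_
    -- Any path in `P` will do: simple connectedness gives the required compatibility for each of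
    -- them.
    obtain ⟨p⟩ := hP.2 ⟨x.vertex 0, hx.2 0⟩ ⟨x.vertex 1, hx.2 1⟩
    refine ⟨A.EnvFiber (x.vertex 1), inferInstance,
      (A.envExtend (A.envTransport p.ofSubtype)
        (A.norm_envTransport p.ofSubtype)).toNonUnitalStarAlgHom.comp
        (A.canonicalEmbedding.map (x.vertex 0)),
      A.canonicalEmbedding.map (x.vertex 1),
      (A.envExtend_injective _ (A.norm_envTransport p.ofSubtype)).comp (hA.2 _), hA.2 _, fun a ha y => ?_⟩
    refine A.envExtend_canonicalEmbedding_incl (x.le a ha 0) (x.le a ha 1) p.ofSubtype ?_ y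
    -- The elements of the support belong to `P`, so the homotopy exists inside `P`, where loops
    -- contract. It is then pushed into `K`.
    have := (PosetPath.comp_nerve_homotopic_of_simplyConnected hP₁ (a := ⟨a, hx.1 ha⟩)
      (x.le a ha 0) (x.le a ha 1) p).ofSubtype
    simp only [PosetPath.ofSubtype_comp, PosetPath.ofSubtype] at this
    exact this
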